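/- Let $A$ be a finite alphabet and $u\in A^*$. For $k\in\mathbb{N}$ write $u\sim_k v$ if $u$ and $v$ have the same subwords (subsequences) of length at most $k$, and let the minimality index $\rho(u)$ be the least $m\in\mathbb{N}$ such that $u\not\sim_m u'$ for every subword $u'\neq u$ of $u$ (so $\rho(\varepsilon)=0$). Then $\rho(u)$ can be computed in linear time $O(|A|+|u|)$. Precisely: there are a random access machine program $P$ and a constant $C$ such that for every finite alphabet $A$, with its letters numbered $0,\dots,|A|-1$, and every word $u\in A^*$, the program $P$, given $|A|$, $|u|$ and the sequence of (numbers of) letters of $u$, halts with output $\rho(u)$ after at most $C\,(|A|+|u|+1)$ steps, and all numbers stored during the computation are at most $C\,(|A|+|u|+1)$. Here a step is one of: loading a constant, copying a register, addition or truncated subtraction of two registers, reading or writing a memory cell whose address is in a register, a jump, or a jump conditional on a comparison of two registers. -/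

import Mathlib

/-! ## Simon's congruence and the minimality index -/

/-- Simon's congruence of order `k`: `u` and `v` have the same subwords (subsequences) of length
at most `k`. -/
def SimonEquiv {A : Type*} (k : ℕ) (u v : List A) : Prop :=
  ∀ s : List A, s.length ≤ k → (s.Sublist u ↔ s.Sublist v)

/-- `u` is `m`-reduced: no strict subword of `u` is `∼ₘ`-equivalent to `u`, i.e. `u` is minimal
for the subword ordering in its class `[u]ₘ`. -/
def SimonReduced {A : Type*} (m : ℕ) (u : List A) : Prop :=
  ∀ u' : List A, u'.Sublist u → u' ≠ u → ¬ SimonEquiv m u u'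

/-- The minimality index `ρ(u)`: the least `m ∈ ℕ` such that `u` is `m`-reduced. Here `m = 0` is
allowed; this matters for the empty word only, for which it gives `ρ(ε) = 0`. -/
noncomputable def rho {A : Type*} (u : List A) : ℕ :=
  sInf {m : ℕ | SimonReduced m u}

/-- The minimum that defines `rho u` is over a non-empty set. -/
theorem simonReduced_rho {A : Type*} (u : List A) : SimonReduced (rho u) u := by
  have h : {m : ℕ | SimonReduced m u}.Nonempty :=
    ⟨u.length, fun u' hs hne h => hne (hs.antisymm ((h u le_rfl).1 (List.Sublist.refl u)))⟩
  exact Nat.sInf_mem h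

/-! ## Random access machines -/

namespace RAM

/-- Instructions of a random access machine. The arguments `d a b` are register numbers, `c` is a
constant, `l` is a program address. -/
inductive Instr where
  /-- `reg[d] := c` -/
  | const (d c : ℕ)
  /-- `reg[d] := reg[a]` -/
  | move (d a : ℕ)
  /-- `reg[d] := reg[a] + reg[b]` -/
  | add (d a b : ℕ)
  /-- `reg[d] := max (reg[a] - reg[b]) 0` -/
  | sub (d a b : ℕ)
  /-- `reg[d] := mem[reg[a]]` -/
  | load (d a : ℕ)
  /-- `mem[reg[a]] := reg[b]` -/
  | store (a b : ℕ)
  /-- unconditional jump to `l` -/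
  | jump (l : ℕ)
  /-- jump to `l` if `reg[a] < reg[b]` -/
  | jumpLt (a b l : ℕ)

/-- A program is a finite list of instructions. -/
abbrev Program := List Instr

/-- A configuration: program counter, registers, memory. A program names its registers explicitly,
so it uses only finitely many of them; memory cells are addressed through registers. -/
@[ext]
structure Config where
  pc : ℕ
  reg : ℕ → ℕ
  mem : ℕ → ℕ

/-- Effect of a single instruction. -/
def Instr.exec : Instr → Config → Config
  | .const d x, c => ⟨c.pc + 1, Function.update c.reg d x, c.mem⟩
  | .move d a, c => ⟨c.pc + 1, Function.update c.reg d (c.reg a), c.mem⟩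
  | .add d a b, c => ⟨c.pc + 1, Function.update c.reg d (c.reg a + c.reg b), c.mem⟩
  | .sub d a b, c => ⟨c.pc + 1, Function.update c.reg d (c.reg a - c.reg b), c.mem⟩
  | .load d a, c => ⟨c.pc + 1, Function.update c.reg d (c.mem (c.reg a)), c.mem⟩
  | .store a b, c => ⟨c.pc + 1, c.reg, Function.update c.mem (c.reg a) (c.reg b)⟩
  | .jump l, c => ⟨l, c.reg, c.mem⟩
  | .jumpLt a b l, c => ⟨if c.reg a < c.reg b then l else c.pc + 1, c.reg, c.mem⟩

/-- The machine has halted when the program counter has left the program. -/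
def Halted (P : Program) (c : Config) : Prop := P.length ≤ c.pc

/-- One step of the machine; a halted machine does not move. -/
def step (P : Program) (c : Config) : Config :=
  match P[c.pc]? with
  | some i => i.exec c
  | none => c

/-- All registers and memory cells hold numbers at most `W`. -/
def Config.Bounded (c : Config) (W : ℕ) : Prop :=
  (∀ i, c.reg i ≤ W) ∧ (∀ i, c.mem i ≤ W)

/-- Initial configuration for a word `w` over the alphabet `{0, …, n-1}`: register `0` holds `n`,
register `1` holds `|w|`, memory cells `0, …, |w|-1` hold the letters of `w`; everything else
is `0`. -/
def input (n : ℕ) (w : List ℕ) : Config where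
  pc := 0
  reg := fun i => if i = 0 then n else if i = 1 then w.length else 0
  mem := fun i => w.getD i 0

/-- Started in `c`, the program `P` halts after at most `T` steps with `out` in register `0`, and
every number stored at any time of the computation is at most `W`. -/
def ComputesWithin (P : Program) (c : Config) (out T W : ℕ) : Prop :=
  ∃ t ≤ T, Halted P ((step P)^[t] c) ∧ ((step P)^[t] c).reg 0 = out ∧
    ∀ s ≤ t, ((step P)^[s] c).Bounded W

end RAM

/-! Every strict subword of `u` survives the deletion of a single letter, so only deletions `u₁ ++ a
:: u₂ ↦ u₁ ++ u₂` matter. A shortest subword destroyed by such a deletion is a shortest `s₁` in `u₁`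
with `s₁ ++ [a]` not in `u₁`, then `a`, then a shortest `s₂` in `u₂` with `a :: s₂` not in `u₂`.
Hence `rho u` is the maximum over all positions of both side distances plus one (`simonReduced_iff`,
`rho_eq_sub_one`).

Side distances obey a recursion: reading `b` at distance `r` caps every other letter's distance at
`r + 1` and sets that of `b` to `r + 1`. One pass computes them from the table of last occurrences
and a stack of thresholds: the distance of `a` is the largest height whose threshold is at most the
last occurrence of `a` (`stack_iff` in `PassInv`). Reading a letter pops down to its distance and
adds at most two entries, so the potential `4 * top` yields linear time (`PassInv.runsTo_end`). An
upward and a downward pass give the two sides. -/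

/-! ## Side distances and the minimality index -/

section Combinatorics

variable {A : Type*}

/-- The length of a shortest subword `s` of `u` such that `a :: s` is not a subword of `u`. -/
def leftDist [DecidableEq A] : List A → A → ℕ
  | [], _ => 0
  | b :: u, a => if a = b then leftDist u b + 1 else min (leftDist u a) (leftDist u b + 1)

/-- Either `s` already embeds in the tail, or it starts with the head `b` and its remainder is a
witness for `b` in the tail; these are the two terms of the minimum. -/
theorem leftDist_le [DecidableEq A] {u s : List A} {a : A} (hs : s.Sublist u)
    (ha : ¬ (a :: s).Sublist u) : leftDist u a ≤ s.length := by
  induction u generalizing s a with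
  | nil => simp [leftDist]
  | cons b u ih =>
    by_cases hsu : s.Sublist u
    · have hab : a ≠ b := by
        rintro rfl
        exact ha (hsu.cons_cons a)
      rw [leftDist, if_neg hab]
      exact (min_le_left _ _).trans (ih hsu fun h => ha (h.cons b))
    · cases hs with
      | cons _ h => exact absurd h hsu
      | cons_cons _ h =>
        rename_i t
        have := ih h hsu
        rw [leftDist, List.length_cons]
        split_ifs
        · omega
        · exact (min_le_right _ _).trans (by omega)

theorem exists_length_eq_leftDist [DecidableEq A] (u : List A) (a : A) :
    ∃ s : List A, s.Sublist u ∧ ¬ (a :: s).Sublist u ∧ s.length = leftDist u a := by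
  induction u generalizing a with
  | nil => exact ⟨[], by simp, by simp, by simp [leftDist]⟩
  | cons b u ih =>
    obtain ⟨s, hs, hbs, hl⟩ := ih b
    have hb : ¬ (a :: b :: s).Sublist (b :: u) := by
      intro h
      cases h with
      | cons _ h => exact hbs ((List.sublist_cons_self a _).trans h)
      | cons_cons _ h => exact hbs h
    by_cases hab : a = b
    · exact ⟨b :: s, hs.cons_cons b, hb, by simp [leftDist, hab, hl]⟩
    · rw [leftDist, if_neg hab]
      rcases min_choice (leftDist u a) (leftDist u b + 1) with h | h <;> rw [h]
      · obtain ⟨t, ht, hat, htl⟩ := ih a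
        refine ⟨t, ht.cons b, fun h => ?_, htl⟩
        cases h with
        | cons _ h => exact hat h
        | cons_cons _ h => exact hab rfl
      · exact ⟨b :: s, hs.cons_cons b, hb, by simp [hl]⟩

/-- An embedding is cut at the border of `u₁` and `u₂`; the letter `a` falls on one side, and either
side is excluded. -/
theorem not_append_cons_sublist_append {s₁ s₂ u₁ u₂ : List A} {a : A}
    (h₁ : ¬ (s₁ ++ [a]).Sublist u₁) (h₂ : ¬ (a :: s₂).Sublist u₂) :
    ¬ (s₁ ++ a :: s₂).Sublist (u₁ ++ u₂) := by
  intro h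
  obtain ⟨t₁, t₂, ht, ht₁, ht₂⟩ := List.sublist_append_iff.1 h
  rcases List.append_eq_append_iff.1 ht with ⟨v, hv, hv'⟩ | ⟨v, hv, hv'⟩
  · cases v with
    | nil =>
      simp only [List.nil_append] at hv'
      exact h₂ (hv' ▸ ht₂)
    | cons b v =>
      obtain ⟨rfl, -⟩ : a = b ∧ _ := by simpa using hv'
      refine h₁ (List.Sublist.trans ?_ ht₁)
      rw [hv]
      simp
  · refine h₂ (List.Sublist.trans ?_ ht₂)
    rw [hv']
    exact List.sublist_append_right _ _

theorem exists_eq_append_cons_of_sublist_of_ne {u' u : List A} (h : u'.Sublist u) (hne : u' ≠ u) :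
    ∃ (u₁ : List A) (a : A) (u₂ : List A), u = u₁ ++ a :: u₂ ∧ u'.Sublist (u₁ ++ u₂) := by
  induction h with
  | slnil => exact absurd rfl hne
  | cons a h => exact ⟨[], a, _, rfl, h⟩
  | cons_cons b h ih =>
    obtain ⟨u₁, a, u₂, rfl, h'⟩ := ih fun h => hne (by rw [h])
    exact ⟨b :: u₁, a, u₂, rfl, h'.cons_cons b⟩

theorem simonReduced_iff [DecidableEq A] (m : ℕ) (u : List A) :
    SimonReduced m u ↔ ∀ (u₁ : List A) (a : A) (u₂ : List A), u = u₁ ++ a :: u₂ →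
      leftDist u₁.reverse a + leftDist u₂ a + 1 ≤ m := by
  constructor
  · rintro h u₁ a u₂ rfl
    have hsub : (u₁ ++ u₂).Sublist (u₁ ++ a :: u₂) := by simp
    have hne : ¬ SimonEquiv m (u₁ ++ a :: u₂) (u₁ ++ u₂) := h _ hsub (by simp)
    simp only [SimonEquiv, not_forall] at hne
    obtain ⟨s, hsm, hs⟩ := hne
    have hsu : s.Sublist (u₁ ++ a :: u₂) := by
      by_contra h'
      exact hs ⟨fun h => absurd h h', fun h => absurd (h.trans hsub) h'⟩
    have hsu' : ¬ s.Sublist (u₁ ++ u₂) := fun h' => hs ⟨fun _ => h', fun _ => hsu⟩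
    -- The embedding of `s` must use the deleted `a`, which splits `s` into witnesses for both side
    -- distances.
    obtain ⟨s₁, t, rfl, hs₁, ht⟩ := List.sublist_append_iff.1 hsu
    cases ht with
    | cons _ ht => exact absurd (hs₁.append ht) hsu'
    | cons_cons _ hs₂ =>
      rename_i s₂
      have h₁ : leftDist u₁.reverse a ≤ s₁.reverse.length := by
        refine leftDist_le (List.reverse_sublist.2 hs₁) fun h' => hsu' ?_
        have h'' : (s₁ ++ [a]).Sublist u₁ := by
          rw [← List.reverse_sublist]
          simpa using h'
        simpa using h''.append hs₂
      have h₂ : leftDist u₂ a ≤ s₂.length :=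
        leftDist_le hs₂ fun h' => hsu' (hs₁.append h')
      simp only [List.length_append, List.length_cons, List.length_reverse] at *
      omega
  · intro h u' hu' hne heq
    obtain ⟨u₁, a, u₂, rfl, hsub⟩ := exists_eq_append_cons_of_sublist_of_ne hu' hne
    obtain ⟨s₁, hs₁, has₁, hl₁⟩ := exists_length_eq_leftDist u₁.reverse a
    obtain ⟨s₂, hs₂, has₂, hl₂⟩ := exists_length_eq_leftDist u₂ a
    have hm := h u₁ a u₂ rfl
    have hs₁' : s₁.reverse.Sublist u₁ := by
      rw [← List.reverse_sublist]
      simpa using hs₁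
    have has₁' : ¬ (s₁.reverse ++ [a]).Sublist u₁ := by
      rw [← List.reverse_sublist]
      simpa using has₁
    have := (heq (s₁.reverse ++ a :: s₂) (by simp; omega)).1 (hs₁'.append (hs₂.cons_cons a))
    exact not_append_cons_sublist_append has₁' has₂ (this.trans hsub)

/-- The side distance of the first letter of a word from the rest of the word, plus one. -/
def headDist [DecidableEq A] : List A → ℕ
  | [] => 0
  | b :: u => leftDist u b + 1

/-- A number that is the maximum over all positions of the sum of both side distances, plus two,
is one more than the minimality index. -/
theorem rho_eq_sub_one [DecidableEq A] (u : List A) (M : ℕ)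
    (hle : ∀ j < u.length, headDist (u.take (j + 1)).reverse + headDist (u.drop j) ≤ M)
    (hex : M = 0 ∨ ∃ j < u.length, M ≤ headDist (u.take (j + 1)).reverse + headDist (u.drop j)) :
    rho u = M - 1 := by
  have key : ∀ (u₁ : List A) (a : A) (u₂ : List A), u = u₁ ++ a :: u₂ →
      headDist (u.take (u₁.length + 1)).reverse + headDist (u.drop u₁.length)
        = leftDist u₁.reverse a + leftDist u₂ a + 2 := by
    rintro u₁ a u₂ rfl
    have : (u₁ ++ a :: u₂).take (u₁.length + 1) = u₁ ++ [a] := by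
      simp [List.take_append]
    rw [this]
    simp [headDist]
    omega
  have hset : {m : ℕ | SimonReduced m u} = Set.Ici (M - 1) := by
    ext m
    simp only [Set.mem_ofPred_eq, Set.mem_Ici, simonReduced_iff]
    constructor
    · intro h
      -- By `hle`, `M = 0` happens only for the empty word, where truncated subtraction gives the
      -- right value `0`.
      rcases hex with rfl | ⟨j, hj, hM⟩
      · simp
      · have hu : u = u.take j ++ u[j] :: u.drop (j + 1) := by simp
        have h₁ := key _ _ _ hu
        have h₂ := h _ _ _ hu
        rw [List.length_take, min_eq_left hj.le] at h₁
        omega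
    · intro h u₁ a u₂ hu
      have h₁ := hle u₁.length (by simp [hu])
      have h₂ := key _ _ _ hu
      omega
  rw [rho, hset, csInf_Ici]

end Combinatorics

/-! ## Reasoning about runs of a random access machine -/

namespace RAM

/-- From `c`, provided that it is bounded by `W`, the program `P` reaches within `T` steps a
configuration that satisfies `Q`, and all configurations up to there are bounded by `W`. -/
def RunsTo (P : Program) (W T : ℕ) (c : Config) (Q : Config → Prop) : Prop :=
  c.Bounded W → ∃ t ≤ T, Q ((step P)^[t] c) ∧ ∀ s ≤ t, ((step P)^[s] c).Bounded W

section Rules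

variable {P : Program} {W T : ℕ} {Q : Config → Prop}

theorem RunsTo.refl {c : Config} (h : Q c) : RunsTo P W T c Q :=
  fun hc => ⟨0, Nat.zero_le _, h, fun s hs => by simpa [Nat.le_zero.1 hs] using hc⟩

theorem RunsTo.mono {T' : ℕ} {c : Config} (h : RunsTo P W T c Q) (hT : T ≤ T') :
    RunsTo P W T' c Q := fun hc =>
  let ⟨t, ht, hQ, hb⟩ := h hc
  ⟨t, ht.trans hT, hQ, hb⟩

theorem RunsTo.trans {T' : ℕ} {c : Config} {R : Config → Prop} (h : RunsTo P W T c Q)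
    (h' : ∀ c', Q c' → RunsTo P W T' c' R) : RunsTo P W (T + T') c R := by
  intro hc
  obtain ⟨t, ht, hQ, hb⟩ := h hc
  obtain ⟨t', ht', hR, hb'⟩ := h' _ hQ (hb t le_rfl)
  refine ⟨t' + t, by omega, by rwa [Function.iterate_add_apply], fun s hs => ?_⟩
  rcases le_total s t with hst | hst
  · exact hb s hst
  · obtain ⟨d, rfl⟩ := Nat.exists_eq_add_of_le' hst
    rw [Function.iterate_add_apply]
    exact hb' d (by omega)

/-- Since `RunsTo` assumes boundedness, only `const` and `add` leave a size obligation; the other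
instructions never create a larger number. -/
theorem RunsTo.step {c : Config} {i : Instr} (hi : P[c.pc]? = some i)
    (hb : c.Bounded W → (i.exec c).Bounded W) (h : RunsTo P W T (i.exec c) Q) :
    RunsTo P W (T + 1) c Q := by
  intro hc
  have hstep : RAM.step P c = i.exec c := by simp [RAM.step, hi]
  obtain ⟨t, ht, hQ, hb'⟩ := h (hb hc)
  refine ⟨t + 1, by omega, by rwa [Function.iterate_succ_apply, hstep], fun s hs => ?_⟩
  cases s with
  | zero => exact hc
  | succ s =>
    rw [Function.iterate_succ_apply, hstep]
    exact hb' s (by omega)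

variable {pc d a b x l : ℕ} {reg mem : ℕ → ℕ}

theorem Config.Bounded.update_reg {pc' v : ℕ} (h : Config.Bounded ⟨pc, reg, mem⟩ W) (hv : v ≤ W) :
    Config.Bounded ⟨pc', Function.update reg d v, mem⟩ W := by
  refine ⟨fun i => ?_, h.2⟩
  rcases eq_or_ne i d with rfl | hi
  · simpa using hv
  · simpa [hi] using h.1 i

theorem RunsTo.const (hi : P[pc]? = some (.const d x)) (hx : x ≤ W)
    (h : RunsTo P W T ⟨pc + 1, Function.update reg d x, mem⟩ Q) :
    RunsTo P W (T + 1) ⟨pc, reg, mem⟩ Q :=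
  RunsTo.step hi (fun hc => hc.update_reg hx) h

theorem RunsTo.move (hi : P[pc]? = some (.move d a))
    (h : RunsTo P W T ⟨pc + 1, Function.update reg d (reg a), mem⟩ Q) :
    RunsTo P W (T + 1) ⟨pc, reg, mem⟩ Q :=
  RunsTo.step hi (fun hc => hc.update_reg (hc.1 a)) h

theorem RunsTo.add (hi : P[pc]? = some (.add d a b)) (hx : reg a + reg b ≤ W)
    (h : RunsTo P W T ⟨pc + 1, Function.update reg d (reg a + reg b), mem⟩ Q) :
    RunsTo P W (T + 1) ⟨pc, reg, mem⟩ Q :=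
  RunsTo.step hi (fun hc => hc.update_reg hx) h

theorem RunsTo.sub (hi : P[pc]? = some (.sub d a b))
    (h : RunsTo P W T ⟨pc + 1, Function.update reg d (reg a - reg b), mem⟩ Q) :
    RunsTo P W (T + 1) ⟨pc, reg, mem⟩ Q :=
  RunsTo.step hi (fun hc => hc.update_reg ((Nat.sub_le _ _).trans (hc.1 a))) h

theorem RunsTo.load (hi : P[pc]? = some (.load d a))
    (h : RunsTo P W T ⟨pc + 1, Function.update reg d (mem (reg a)), mem⟩ Q) :
    RunsTo P W (T + 1) ⟨pc, reg, mem⟩ Q :=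
  RunsTo.step hi (fun hc => hc.update_reg (hc.2 (reg a))) h

theorem RunsTo.store (hi : P[pc]? = some (.store a b))
    (h : RunsTo P W T ⟨pc + 1, reg, Function.update mem (reg a) (reg b)⟩ Q) :
    RunsTo P W (T + 1) ⟨pc, reg, mem⟩ Q := by
  refine RunsTo.step hi (fun hc => ⟨hc.1, fun i => ?_⟩) h
  simp only [Instr.exec, Function.update_apply]
  split_ifs
  · exact hc.1 b
  · exact hc.2 i

theorem RunsTo.jump (hi : P[pc]? = some (.jump l)) (h : RunsTo P W T ⟨l, reg, mem⟩ Q) :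
    RunsTo P W (T + 1) ⟨pc, reg, mem⟩ Q :=
  RunsTo.step hi (fun hc => hc) h

theorem RunsTo.jumpLt_of_lt (hi : P[pc]? = some (.jumpLt a b l)) (hab : reg a < reg b)
    (h : RunsTo P W T ⟨l, reg, mem⟩ Q) : RunsTo P W (T + 1) ⟨pc, reg, mem⟩ Q :=
  RunsTo.step hi (fun hc => hc) (by simpa only [Instr.exec, if_pos hab] using h)

theorem RunsTo.jumpLt_of_le (hi : P[pc]? = some (.jumpLt a b l)) (hab : reg b ≤ reg a)
    (h : RunsTo P W T ⟨pc + 1, reg, mem⟩ Q) : RunsTo P W (T + 1) ⟨pc, reg, mem⟩ Q :=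
  RunsTo.step hi (fun hc => hc) (by simpa only [Instr.exec, if_neg hab.not_gt] using h)

end Rules

/-! ## The program -/

/-- The program that computes the minimality index. The memory holds the word in the cells
`0, …, L - 1`, for each position the sum of its side distances in the cells `L, …, 2 * L - 1`, and
for each of the two passes over the word (upwards, then downwards) a fresh table of last
occurrences followed by a stack. Registers: `0` alphabet size, `1` word length `L`, `2` the
constant one, `3` number of letters read in this pass, `4` current position, `5` and `6` its
increment and decrement, `7` and `8` base addresses of table and stack, `9` address of the top of
the stack, `10` running maximum, `11` to `15` temporaries. -/
def rhoProgram : Program := [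
  .const 2 1,
  .const 5 1,
  .add 7 1 1,
  -- start of a pass, address 3
  .add 8 7 0,
  .add 9 8 2,
  .store 9 2,
  .const 3 0,
  -- next letter, address 7
  .jumpLt 3 1 9,
  .jump 34,
  .load 11 4,
  .add 11 11 7,
  .load 12 11,
  -- popping the stack, address 12
  .load 13 9,
  .jumpLt 12 13 15,
  .jump 17,
  .sub 9 9 2,
  .jump 12,
  -- update of table, stack, sums and maximum, address 17
  .add 3 3 2,
  .store 11 3,
  .add 9 9 2,
  .sub 14 9 8,
  .add 9 9 2,
  .add 13 3 2,
  .store 9 13,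
  .add 15 4 1,
  .load 13 15,
  .add 13 13 14,
  .store 15 13,
  .jumpLt 10 13 30,
  .jump 31,
  .move 10 13,
  .add 4 4 5,
  .sub 4 4 6,
  .jump 7,
  -- end of a pass, address 34
  .jumpLt 6 5 36,
  .jump 43,
  .const 5 0,
  .const 6 1,
  .sub 4 1 2,
  .add 7 8 1,
  .add 7 7 2,
  .add 7 7 2,
  .jump 3,
  .sub 0 10 2]

/-! ### Effect and cost of the two blocks of the loop body. -/

theorem runsTo_pop {W s r d : ℕ} {reg mem : ℕ → ℕ} (h2 : reg 2 = 1) (h9 : reg 9 = s + (r + d))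
    (hr : mem (s + r) ≤ reg 12) (hd : ∀ j, r < j → j ≤ r + d → reg 12 < mem (s + j)) :
    RunsTo rhoProgram W (4 * d + 3) ⟨12, reg, mem⟩ fun c =>
      c.pc = 17 ∧ c.mem = mem ∧ c.reg 9 = s + r ∧ ∀ j, j ≠ 9 → j ≠ 13 → c.reg j = reg j := by
  induction d generalizing reg with
  | zero =>
    refine .load rfl (.jumpLt_of_le rfl ?_ (.jump rfl (.refl ⟨rfl, rfl, ?_, ?_⟩)))
    · simpa [h9] using hr
    · simpa using h9
    · intro j _ h
      simp [h]
  | succ d ih =>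
    refine .load rfl (.jumpLt_of_lt rfl ?_ (.sub rfl (.jump rfl ?_)))
    · simpa [h9] using hd (r + (d + 1)) (by omega) le_rfl
    · refine (RunsTo.trans (T' := 0) (ih ?_ ?_ ?_ ?_) fun c hc => .refl ?_).mono le_rfl
      · simpa using h2
      · simp [h9, h2]
        omega
      · simpa using hr
      · intro j h h'
        simpa using hd j h (by omega)
      · obtain ⟨h, h', h'', h'''⟩ := hc
        refine ⟨h, h', h'', fun j h9 h13 => ?_⟩
        rw [h''' j h9 h13]
        simp [h9, h13]

/-- The hypothesis `hx` reads the sum cell after the writes to table and stack, so no disjointness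
of addresses is needed here. -/
theorem runsTo_update {W i p L s r q S : ℕ} {reg mem : ℕ → ℕ} (h2 : reg 2 = 1)
    (h3 : reg 3 = i) (h4 : reg 4 = p) (h1 : reg 1 = L) (h8 : reg 8 = S) (h9 : reg 9 = S + r)
    (h11 : reg 11 = q)
    (hx : Function.update (Function.update mem q (i + 1)) (S + r + 2) (i + 2) (p + L) = s)
    (hi : i + 2 ≤ W) (hr : S + r + 2 ≤ W) (hp : p + L ≤ W) (hp' : p + reg 5 ≤ W)
    (hs : s + (r + 1) ≤ W) :
    RunsTo rhoProgram W 16 ⟨17, reg, mem⟩ fun c =>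
      c.pc = 7 ∧ c.mem = Function.update (Function.update (Function.update mem q (i + 1))
        (S + r + 2) (i + 2)) (p + L) (s + (r + 1)) ∧
      c.reg 3 = i + 1 ∧ c.reg 4 = p + reg 5 - reg 6 ∧ c.reg 9 = S + r + 2 ∧
      c.reg 10 = max (reg 10) (s + (r + 1)) ∧
      ∀ j, j ≠ 3 → j ≠ 4 → j ≠ 9 → j ≠ 10 → j ≠ 13 → j ≠ 14 → j ≠ 15 → c.reg j = reg j := by
  have e1 : S + r + 1 - S = r + 1 := by omega
  refine .add rfl ?_ (.store rfl (.add rfl ?_ (.sub rfl (.add rfl ?_ (.add rfl ?_ (.store rfl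
    (.add rfl ?_ (.load rfl (.add rfl ?_ (.store rfl ?_))))))))))
  any_goals simp [h1, h2, h3, h4, h8, h9, h11, hx, e1]
  any_goals omega
  by_cases hmax : reg 10 < s + (r + 1)
  · refine .jumpLt_of_lt rfl ?_ (.move rfl (.add rfl ?_ (.sub rfl (.jump rfl (.refl
      ⟨rfl, ?_, ?_, ?_, ?_, ?_, ?_⟩)))))
    any_goals simp [h4]
    any_goals omega
    intro j j3 j4 j9 j10 j13 j14 j15
    simp [j3, j4, j9, j10, j13, j14, j15]
  · refine .jumpLt_of_le rfl ?_ (.jump rfl (.add rfl ?_ (.sub rfl (.jump rfl (.refl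
      ⟨rfl, ?_, ?_, ?_, ?_, ?_, ?_⟩)))))
    any_goals simp [h4]
    any_goals omega
    intro j j3 j4 j9 _ j13 j14 j15
    simp [j3, j4, j9, j13, j14, j15]

/-! ## A pass over the word -/

section Pass

variable {A : Type*}

/-- An order of traversal of the word `word` of length `L`: at time `j` the position is `σ j`, and
`pre j` is the list of the letters read before time `j`, the last one first. -/
structure Traversal (n L up dn : ℕ) (num : A → ℕ) (word σ : ℕ → ℕ) (pre : ℕ → List A) :
    Prop where
  num_lt : ∀ a, num a < n
  num_inj : Function.Injective num
  up_le : up ≤ 1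
  lt : ∀ j < L, σ j < L
  inj : ∀ j < L, ∀ j' < L, σ j = σ j' → j = j'
  succ : ∀ j, j + 1 < L → σ (j + 1) = σ j + up - dn
  pre_zero : pre 0 = []
  pre_succ : ∀ j < L, ∃ a, pre (j + 1) = a :: pre j ∧ word (σ j) = num a

/-- The invariant of a pass, after `i` letters, with `top` the height of the stack. -/
structure PassInv [DecidableEq A] (n L up dn B : ℕ) (num : A → ℕ) (word σ s₀ : ℕ → ℕ)
    (pre : ℕ → List A) (i top : ℕ) (reg mem : ℕ → ℕ) : Prop where
  reg0 : reg 0 = n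
  reg1 : reg 1 = L
  reg2 : reg 2 = 1
  reg3 : reg 3 = i
  reg4 : i < L → reg 4 = σ i
  reg5 : reg 5 = up
  reg6 : reg 6 = dn
  reg7 : reg 7 = B
  reg8 : reg 8 = B + n
  reg9 : reg 9 = B + n + top
  le : i ≤ L
  top_le : top ≤ i + 1
  word_eq : ∀ j < L, mem j = word j
  sum_done : ∀ j < i, mem (L + σ j) = s₀ (σ j) + headDist (pre (j + 1))
  sum_todo : ∀ j < L, i ≤ j → mem (L + σ j) = s₀ (σ j)
  le_max : ∀ j < i, mem (L + σ j) ≤ reg 10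
  max_le : reg 10 = 0 ∨ ∃ j < L, reg 10 ≤ mem (L + j)
  -- The stack height never exceeds `L + 1`. The zeros beyond it let the next pass start without
  -- clearing memory.
  fresh : ∀ m, B + n + L + 2 ≤ m → mem m = 0
  -- Times in the table count from one; zero means that the letter has not been read.
  last_le : ∀ a, mem (B + num a) ≤ i
  stack_le : ∀ k ≤ top, mem (B + n + k) ≤ i + 1
  stack_top : mem (B + n + top) = i + 1
  stack_iff : ∀ a, ∀ k ≤ top, mem (B + n + k) ≤ mem (B + num a) ↔ k ≤ leftDist (pre i) a

variable [DecidableEq A] {n L up dn B W : ℕ} {num : A → ℕ} {word σ s₀ : ℕ → ℕ} {pre : ℕ → List A}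

/-- The time bound is amortised: a constant plus the drop of the potential `4 * top`, as each pop
costs four steps. -/
theorem PassInv.runsTo_iteration (ht : Traversal n L up dn num word σ pre) (hB : 2 * L ≤ B)
    (hs₀ : ∀ j < L, s₀ j ≤ L) (hW : B + n + L + 2 ≤ W) {i top : ℕ} {reg mem : ℕ → ℕ}
    (h : PassInv n L up dn B num word σ s₀ pre i top reg mem) (hi : i < L) :
    ∃ top', RunsTo rhoProgram W (32 + 4 * top - 4 * (top' - 2)) ⟨7, reg, mem⟩ (fun c => c.pc = 7 ∧
      PassInv n L up dn B num word σ s₀ pre (i + 1) top' c.reg c.mem) ∧ 2 ≤ top' ∧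
      top' ≤ top + 1 := by
  obtain ⟨b, hpre, hb⟩ := ht.pre_succ i hi
  set r := leftDist (pre i) b
  have hσ := ht.lt i hi
  have hcur : mem (σ i) = num b := by rw [h.word_eq _ hσ, hb]
  have hnb := ht.num_lt b
  have htop := h.top_le
  have hs := hs₀ _ hσ
  -- The top entry `i + 1` is a sentinel: it exceeds every recorded time, so it is always popped.
  have hrtop : r < top := by
    by_contra hcon
    have h1 := (h.stack_iff b top le_rfl).2 (not_lt.1 hcon)
    have h2 := h.last_le b
    have h3 := h.stack_top
    omega
  have hup := ht.up_le
  refine ⟨r + 2, ?_, by omega, by omega⟩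
  refine RunsTo.mono (T := (4 * (top - r) + 3 + 18) + 1 + 1 + 1 + 1) ?_ (by omega)
  refine .jumpLt_of_lt rfl (by rw [h.reg3, h.reg1]; exact hi) (.load rfl (.add rfl ?_ (.load rfl
    (.trans (T := 4 * (top - r) + 3) (T' := 18)
      (runsTo_pop (s := B + n) (r := r) (d := top - r) ?_ ?_ ?_ ?_) ?_))))
  · simp [h.reg4 hi, hcur, h.reg7]
    omega
  · simp [h.reg2]
  · simp [h.reg9]
    omega
  · simpa [h.reg4 hi, hcur, h.reg7, Nat.add_comm (num b)] using
      (h.stack_iff b r hrtop.le).2 le_rfl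
  · intro j hj hj'
    have := (h.stack_iff b j (by omega)).not.2 (by omega)
    simpa [h.reg4 hi, hcur, h.reg7, Nat.add_comm (num b)] using this
  rintro ⟨pc, reg', mem'⟩ ⟨rfl, rfl, h9, hreg⟩
  simp only at h hcur h9 hreg ⊢
  have g0 : reg' 0 = n := by simpa [h.reg0] using hreg 0
  have g1 : reg' 1 = L := by simpa [h.reg1] using hreg 1
  have g2 : reg' 2 = 1 := by simpa [h.reg2] using hreg 2
  have g3 : reg' 3 = i := by simpa [h.reg3] using hreg 3
  have g4 : reg' 4 = σ i := by simpa [h.reg4 hi] using hreg 4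
  have g5 : reg' 5 = up := by simpa [h.reg5] using hreg 5
  have g6 : reg' 6 = dn := by simpa [h.reg6] using hreg 6
  have g7 : reg' 7 = B := by simpa [h.reg7] using hreg 7
  have g8 : reg' 8 = B + n := by simpa [h.reg8] using hreg 8
  have g10 : reg' 10 = reg 10 := by simpa using hreg 10
  have g11 : reg' 11 = B + num b := by
    simpa [h.reg4 hi, hcur, h.reg7, Nat.add_comm (num b)] using hreg 11
  clear hreg
  have hsum := h.sum_todo i hi le_rfl
  refine RunsTo.trans (T := 16) (T' := 2) (runsTo_update (W := W) g2 g3 g4 g1 g8 h9 g11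
    (s := s₀ (σ i)) ?_ (by omega) (by omega) (by omega) (by omega) (by omega)) ?_
  · rw [Function.update_of_ne (by omega), Function.update_of_ne (by omega), Nat.add_comm, hsum]
  rintro ⟨pc, reg'', mem''⟩ ⟨rfl, hmem, k3, k4, k9, k10, hreg⟩
  simp only at hmem k3 k4 k9 k10 hreg ⊢
  have k0 : reg'' 0 = n := by simpa [g0] using hreg 0
  have k1 : reg'' 1 = L := by simpa [g1] using hreg 1
  have k2 : reg'' 2 = 1 := by simpa [g2] using hreg 2
  have k5 : reg'' 5 = up := by simpa [g5] using hreg 5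
  have k6 : reg'' 6 = dn := by simpa [g6] using hreg 6
  have k7 : reg'' 7 = B := by simpa [g7] using hreg 7
  have k8 : reg'' 8 = B + n := by simpa [g8] using hreg 8
  clear hreg
  rw [g10] at k10
  rw [g5, g6] at k4
  clear g0 g1 g2 g3 g4 g5 g6 g7 g8 g10 g11 h9
  refine .refl ⟨rfl, ?_⟩
  have mlow : ∀ j < L, mem'' j = mem' j := by
    intro j hj
    simp only [hmem]
    rw [Function.update_of_ne (by omega), Function.update_of_ne (by omega),
      Function.update_of_ne (by omega)]
  have msum : mem'' (L + σ i) = s₀ (σ i) + (r + 1) := by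
    rw [hmem, Nat.add_comm L, Function.update_self]
  have msum' : ∀ j < L, j ≠ σ i → mem'' (L + j) = mem' (L + j) := by
    intro j hj hji
    simp only [hmem]
    rw [Function.update_of_ne (by omega), Function.update_of_ne (by omega),
      Function.update_of_ne (by omega)]
  have mlast : ∀ a, mem'' (B + num a) = if a = b then i + 1 else mem' (B + num a) := by
    intro a
    have hna := ht.num_lt a
    simp only [hmem]
    rw [Function.update_of_ne (by omega), Function.update_of_ne (by omega)]
    split_ifs with hab
    · rw [hab, Function.update_self]
    · rw [Function.update_of_ne]
      intro hcon
      exact hab (ht.num_inj (by omega))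
  -- Entry `r + 1` was popped but not overwritten; raising the stack pointer takes it back as a
  -- threshold.
  have mstack : ∀ k ≤ r + 1, mem'' (B + n + k) = mem' (B + n + k) := by
    intro k hk
    simp only [hmem]
    rw [Function.update_of_ne (by omega), Function.update_of_ne (by omega),
      Function.update_of_ne (by omega)]
  have mtop : mem'' (B + n + (r + 2)) = i + 2 := by
    simp only [hmem]
    rw [Function.update_of_ne (by omega), Nat.add_assoc _ r 2 |>.symm, Function.update_self]
  have mfresh : ∀ m, B + n + L + 2 ≤ m → mem'' m = 0 := by
    intro m hm
    simp only [hmem]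
    rw [Function.update_of_ne (by omega), Function.update_of_ne (by omega),
      Function.update_of_ne (by omega), h.fresh m hm]
  clear hmem
  have hσne : ∀ j < L, j ≠ i → σ j ≠ σ i := fun j hj hji hcon => hji (ht.inj j hj i hi hcon)
  simp only
  constructor
  case reg0 => exact k0
  case reg1 => exact k1
  case reg2 => exact k2
  case reg3 => exact k3
  case reg4 => exact fun hi' => by rw [k4, ht.succ i hi']
  case reg5 => exact k5
  case reg6 => exact k6
  case reg7 => exact k7
  case reg8 => exact k8
  case reg9 => rw [k9]; rfl
  case le => exact hi
  case top_le => omega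
  case word_eq => exact fun j hj => by rw [mlow j hj, h.word_eq j hj]
  case sum_done =>
    intro j hj
    rcases eq_or_ne j i with rfl | hji
    · rw [msum, hpre, headDist]
    · rw [msum' _ (ht.lt j (by omega)) (hσne j (by omega) hji), h.sum_done j (by omega)]
  case sum_todo =>
    intro j hj hij
    rw [msum' _ (ht.lt j hj) (hσne j hj (by omega)), h.sum_todo j hj (by omega)]
  case le_max =>
    intro j hj
    rw [k10]
    rcases eq_or_ne j i with rfl | hji
    · rw [msum]
      exact le_max_right _ _
    · rw [msum' _ (ht.lt j (by omega)) (hσne j (by omega) hji)]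
      exact (h.le_max j (by omega)).trans (le_max_left _ _)
  case max_le =>
    rw [k10]
    rcases le_total (reg 10) (s₀ (σ i) + (r + 1)) with hle | hle
    · rw [max_eq_right hle]
      exact Or.inr ⟨σ i, hσ, msum.ge⟩
    · rw [max_eq_left hle]
      refine h.max_le.imp id ?_
      rintro ⟨j, hj, hmx⟩
      refine ⟨j, hj, hmx.trans ?_⟩
      -- If the bounding cell is the one being written, its value only grows.
      rcases eq_or_ne j (σ i) with rfl | hji
      · rw [msum, hsum]
        omega
      · rw [msum' j hj hji]
  case fresh => exact mfresh
  case last_le =>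
    intro a
    rw [mlast]
    have := h.last_le a
    split_ifs <;> omega
  case stack_le =>
    intro k hk
    rcases Nat.lt_or_eq_of_le hk with hk | rfl
    · rw [mstack k (by omega)]
      have := h.stack_le k (by omega)
      omega
    · rw [mtop]
  case stack_top => rw [mtop]
  case stack_iff =>
    intro a k hk
    have hla := h.last_le a
    rw [mlast, hpre, leftDist]
    -- For `k ≤ r + 1` the cap `r + 1` is harmless, and for `a = b` both sides hold. The new
    -- sentinel at `r + 2` makes both sides fail.
    rcases Nat.lt_or_eq_of_le hk with hk | rfl
    · rw [mstack k (by omega)]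
      have h1 := h.stack_le k (by omega)
      have h2 := h.stack_iff a k (by omega)
      split_ifs
      · omega
      · rw [h2, le_min_iff]
        omega
    · rw [mtop]
      split_ifs
      · omega
      · rw [le_min_iff]
        omega

/-- The amortised bounds telescope: `40` is `32` plus the potential of two entries. -/
theorem PassInv.runsTo_end (ht : Traversal n L up dn num word σ pre) (hB : 2 * L ≤ B)
    (hs₀ : ∀ j < L, s₀ j ≤ L) (hW : B + n + L + 2 ≤ W) {i top : ℕ} {reg mem : ℕ → ℕ}
    (h : PassInv n L up dn B num word σ s₀ pre i top reg mem) :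
    RunsTo rhoProgram W (40 * (L - i) + 4 * top + 2) ⟨7, reg, mem⟩ fun c => c.pc = 34 ∧
      ∃ top', PassInv n L up dn B num word σ s₀ pre L top' c.reg c.mem := by
  induction hd : L - i generalizing i top reg mem with
  | zero =>
    obtain rfl : i = L := by have := h.le; omega
    refine RunsTo.mono (T := 2) ?_ (by omega)
    exact .jumpLt_of_le rfl (by rw [h.reg1, h.reg3]) (.jump rfl (.refl ⟨rfl, top, h⟩))
  | succ d ih =>
    obtain ⟨top', hrun, h2, htop⟩ := h.runsTo_iteration ht hB hs₀ hW (by omega)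
    refine (hrun.trans (T' := 40 * d + 4 * top' + 2) ?_).mono (by omega)
    rintro ⟨pc, reg', mem'⟩ ⟨rfl, h'⟩
    exact ih h' (by omega)

theorem runsTo_pass (ht : Traversal n L up dn num word σ pre) (hB : 2 * L ≤ B)
    (hs₀ : ∀ j < L, s₀ j ≤ L) (hW : B + n + L + 2 ≤ W) {reg mem : ℕ → ℕ}
    (h0 : reg 0 = n) (h1 : reg 1 = L) (h2 : reg 2 = 1) (h4 : 0 < L → reg 4 = σ 0)
    (h5 : reg 5 = up) (h6 : reg 6 = dn) (h7 : reg 7 = B) (hword : ∀ j < L, mem j = word j)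
    (hsum : ∀ j < L, mem (L + j) = s₀ j) (hfresh : ∀ m, B ≤ m → mem m = 0)
    (hmax : reg 10 = 0 ∨ ∃ j < L, reg 10 ≤ mem (L + j)) :
    RunsTo rhoProgram W (40 * L + 10) ⟨3, reg, mem⟩ fun c => c.pc = 34 ∧
      ∃ top, PassInv n L up dn B num word σ s₀ pre L top c.reg c.mem := by
  refine RunsTo.mono (T := (40 * L + 4 * 1 + 2) + 1 + 1 + 1 + 1) ?_ (by omega)
  -- The initial stack is the untouched zero at the bottom, which is never popped, and the sentinel
  -- `1` above it.
  refine .add rfl ?_ (.add rfl ?_ (.store rfl (.const rfl (Nat.zero_le _)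
    (PassInv.runsTo_end ht hB hs₀ hW (i := 0) (top := 1) ?_))))
  · omega
  · simp [h0, h2, h7]
    omega
  have hmem : ∀ m, m ≠ B + n + 1 → Function.update mem (B + n + 1) 1 m = mem m :=
    fun m hm => Function.update_of_ne hm _ _
  simp [h0, h2, h7]
  constructor
  case reg4 => simpa using h4
  case word_eq =>
    intro j hj
    rw [hmem _ (by omega), hword j hj]
  case sum_done => simp
  case sum_todo =>
    intro j hj _
    have := ht.lt j hj
    rw [hmem _ (by omega), hsum _ this]
  case le_max => simp
  case max_le =>
    simp
    refine hmax.imp id ?_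
    rintro ⟨j, hj, hle⟩
    exact ⟨j, hj, by rwa [hmem _ (by omega)]⟩
  case fresh =>
    intro m hm
    rw [hmem _ (by omega), hfresh m (by omega)]
  case last_le =>
    intro a
    have := ht.num_lt a
    rw [hmem _ (by omega), hfresh _ (by omega)]
  case stack_le =>
    intro k hk
    rcases Nat.lt_or_eq_of_le hk with hk | rfl
    · rw [hmem _ (by omega), hfresh _ (by omega)]
      omega
    · simp
  case stack_top => simp
  case stack_iff =>
    intro a k hk
    have := ht.num_lt a
    rw [hmem (B + num a) (by omega), hfresh (B + num a) (by omega), ht.pre_zero]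
    rcases Nat.lt_or_eq_of_le hk with hk | rfl
    · rw [hmem _ (by omega), hfresh _ (by omega)]
      simp [leftDist]
      omega
    · simp [leftDist]
  all_goals simp [*]

end Pass

/-! ## Correctness of the program -/

section Main

variable {A : Type*}

theorem traversal_upwards {n : ℕ} {num : A → ℕ} (hlt : ∀ a, num a < n)
    (hinj : Function.Injective num) (u : List A) :
    Traversal n u.length 1 0 num (fun j => (u.map num).getD j 0) id
      fun j => (u.take j).reverse where
  num_lt := hlt
  num_inj := hinj
  up_le := le_rfl
  lt _ h := h
  inj _ _ _ _ h := h
  succ _ _ := rfl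
  pre_zero := by simp
  pre_succ j h := ⟨u[j], by rw [List.take_add_one, List.getElem?_eq_getElem h]; simp,
    by simp [h]⟩

theorem traversal_downwards {n : ℕ} {num : A → ℕ} (hlt : ∀ a, num a < n)
    (hinj : Function.Injective num) (u : List A) :
    Traversal n u.length 0 1 num (fun j => (u.map num).getD j 0) (fun j => u.length - 1 - j)
      fun j => u.drop (u.length - j) where
  num_lt := hlt
  num_inj := hinj
  up_le := Nat.zero_le _
  lt _ h := by omega
  inj _ _ _ _ h := by omega
  succ _ _ := by omega
  pre_zero := by simp
  pre_succ j h := by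
    have hj : u.length - 1 - j < u.length := by omega
    refine ⟨u[u.length - 1 - j], ?_, by simp [hj]⟩
    rw [show u.length - (j + 1) = u.length - 1 - j by omega, List.drop_eq_getElem_cons hj]
    congr 2
    omega

variable [DecidableEq A]

theorem leftDist_le_length (u : List A) (a : A) : leftDist u a ≤ u.length :=
  leftDist_le (List.Sublist.refl u) fun h => by simpa using h.length_le

theorem headDist_le_length (u : List A) : headDist u ≤ u.length := by
  cases u with
  | nil => simp [headDist]
  | cons a u => simpa [headDist] using leftDist_le_length u a

theorem runsTo_rho {n W : ℕ} {num : A → ℕ} (hlt : ∀ a, num a < n)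
    (hinj : Function.Injective num) (u : List A) (hW : 10 * (n + u.length + 1) ≤ W) :
    RunsTo rhoProgram W (100 * (n + u.length + 1)) (input n (u.map num)) fun c =>
      Halted rhoProgram c ∧ c.reg 0 = rho u := by
  have hdown := traversal_downwards hlt hinj u
  have hup := traversal_upwards hlt hinj u
  set L := u.length with hL
  have hs : ∀ j < L, headDist (u.take (j + 1)).reverse ≤ L := fun j hj =>
    (headDist_le_length _).trans (by simp [hL])
  refine RunsTo.mono (T := ((40 * L + 10) + ((40 * L + 10 + 3) + 8)) + 1 + 1 + 1) ?_ (by omega)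
  refine .const rfl (by omega) (.const rfl (by omega) (.add rfl ?_
    (.trans (T := 40 * L + 10) (T' := (40 * L + 10 + 3) + 8)
      (runsTo_pass (W := W) (B := 2 * L) (s₀ := fun _ => 0) hup le_rfl ?_ ?_
        ?_ ?_ ?_ ?_ ?_ ?_ ?_ ?_ ?_ ?_ ?_) ?_)))
  any_goals simp [← hL]
  any_goals omega
  · intro m hm
    rw [List.getElem?_eq_none (by omega)]
    rfl
  rintro ⟨pc, reg, mem⟩ hpc top h
  obtain rfl : pc = 34 := hpc
  simp only at h
  have hsum : ∀ j < L, mem (L + j) = headDist (u.take (j + 1)).reverse := by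
    intro j hj
    simpa using h.sum_done j hj
  refine .jumpLt_of_lt rfl (by simp [h.reg5, h.reg6]) (.const rfl (by omega) (.const rfl (by omega)
    (.sub rfl (.add rfl ?_ (.add rfl ?_ (.add rfl ?_ (.jump rfl
      (.trans (T := 40 * L + 10) (T' := 3)
        -- The second table starts just past the stack area of the first pass.
        (runsTo_pass (W := W) (B := 2 * L + n + L + 2)
          (s₀ := fun j => headDist (u.take (j + 1)).reverse) hdown (by omega) hs (by omega)
          ?_ ?_ ?_ ?_ ?_ ?_ ?_ (by simpa using h.word_eq) hsum h.fresh ?_) ?_))))))))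
  any_goals simp [h.reg0, h.reg1, h.reg2, h.reg8]
  any_goals omega
  -- The maximum is not reset: it is bounded by a sum cell, and the second pass only increases
  -- those.
  · exact h.max_le
  clear h
  rintro ⟨pc, reg, mem⟩ hpc top h
  obtain rfl : pc = 34 := hpc
  simp only at h
  refine .jumpLt_of_le rfl (by simp [h.reg5, h.reg6]) (.jump rfl (.sub rfl (.refl ⟨?_, ?_⟩)))
  · simp [Halted, rhoProgram]
  have hsum : ∀ j < L, mem (L + j) = headDist (u.take (j + 1)).reverse + headDist (u.drop j) := by
    intro j hj
    -- The downward pass reads position `j` at time `L - 1 - j`.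
    have := h.sum_done (L - 1 - j) (by omega)
    rwa [show L - 1 - (L - 1 - j) = j by omega, show L - (L - 1 - j + 1) = j by omega] at this
  simp only [Function.update_self, h.reg2]
  refine (rho_eq_sub_one u (reg 10) (fun j hj => ?_) ?_).symm
  · have := h.le_max (L - 1 - j) (by omega)
    rwa [show L - 1 - (L - 1 - j) = j by omega, hsum j hj] at this
  · refine h.max_le.imp id ?_
    rintro ⟨j, hj, hle⟩
    exact ⟨j, hj, hsum j hj ▸ hle⟩

end Main

end RAM

theorem mainTheorem8 :
    ∃ (P : RAM.Program) (C : ℕ),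
      ∀ (A : Type*) [Fintype A] (e : A ≃ Fin (Fintype.card A)) (u : List A),
        RAM.ComputesWithin P
          (RAM.input (Fintype.card A) (u.map fun a => (e a : ℕ)))
          (rho u)
          (C * (Fintype.card A + u.length + 1))
          (C * (Fintype.card A + u.length + 1)) := by
  classical
  refine ⟨RAM.rhoProgram, 100, fun A _ e u => ?_⟩
  have hlt : ∀ a, (e a : ℕ) < Fintype.card A := fun a => (e a).isLt
  have hinj : Function.Injective fun a => (e a : ℕ) := Fin.val_injective.comp e.injective
  have hb : (RAM.input (Fintype.card A) (u.map fun a => (e a : ℕ))).Bounded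
      (100 * (Fintype.card A + u.length + 1)) := by
    constructor
    · intro i
      simp only [RAM.input, List.length_map]
      split_ifs <;> omega
    · intro i
      simp only [RAM.input, List.getD_eq_getElem?_getD, List.getElem?_map]
      cases u[i]? with
      | none => simp
      | some a =>
        have := hlt a
        simp only [Option.map_some, Option.getD_some]
        omega
  obtain ⟨t, ht, ⟨hh, ho⟩, hs⟩ := RAM.runsTo_rho hlt hinj u (by omega) hb
  exact ⟨t, ht, hh, ho, hs⟩
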